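/- Let $N=\{1,\dots,n\}$ be a finite set of agents; agent $j$ owns exactly one object, denoted $j$ as well, so $N$ is also the set of objects. A preference profile $R=(R_j)_{j\in N}$ consists of a complete and transitive relation $R_j$ on $N$ (ties allowed) for each agent $j$, with strict part $P_j$ and indifference part $I_j$; similarly for $\tilde R$, $\tilde P_j$. Object $k$ is acceptable to $j$ at $R$ if $k\,R_j\,j$. An allocation is a vector $x=(x_j)_{j\in N}\in N^N$ with $\{x_j : j\in N\}=N$. A non-empty coalition $S\subseteq N$ weakly blocks $x$ at $R$ if there is an allocation $z$ with $\{z_j : j\in S\}=S$, $z_j\,R_j\,x_j$ for all $j\in S$, and $z_j\,P_j\,x_j$ for some $j\in S$. The strong core $\mathcal{SC}(R)$ is the (possibly empty) set of allocations that no coalition weakly blocks at $R$. For $i\in N$, the profile $\tilde R$ is an improvement for $i$ with respect to $R$ if 1. $\tilde R_i=R_i$; 2. for all $j\ne i$ and all $k$ with $k\,R_j\,j$: $i\,I_j\,k$ implies $i\,\tilde R_j\,k$, and $i\,P_j\,k$ implies $i\,\tilde P_j\,k$; 3. for all $j\ne i$ and all $k,l\ne i$ with $k\,R_j\,j$ and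 $l\,R_j\,j$: $k\,R_j\,l$ if and only if $k\,\tilde R_j\,l$; 4. for all $j\ne i$ and all $k\ne i$: if $k$ is not acceptable to $j$ at $R$, then $k$ is not acceptable to $j$ at $\tilde R$. **Theorem.** Let $i\in N$, and let $R,\tilde R$ be preference profiles such that $\tilde R$ is an improvement for $i$ with respect to $R$. If $\mathcal{SC}(R)\neq\emptyset$ and $\mathcal{SC}(\tilde R)\neq\emptyset$, then for each $\tilde x\in\mathcal{SC}(\tilde R)$ and each $x\in\mathcal{SC}(R)$ we have $\tilde x_i\,R_i\,x_i$. (This is what is meant by saying that the strong core conditionally respects improvement.) -/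

import Mathlib

/-- Complete and transitive (weak) preferences over a set `X` of objects. `R.weak k l` reads
"object `k` is at least as good as object `l`". -/
structure Preference (X : Type*) where
  weak : X → X → Prop
  complete : ∀ k l, weak k l ∨ weak l k
  trans : ∀ k l m, weak k l → weak l m → weak k m

namespace Preference

variable {X : Type*}

/-- Strict part: `k` is at least as good as `l`, but not conversely. -/
def strict (P : Preference X) (k l : X) : Prop := P.weak k l ∧ ¬ P.weak l k

/-- Indifference part. -/
def indiff (P : Preference X) (k l : X) : Prop := P.weak k l ∧ P.weak l k

end Preference

namespace HousingMarket

/-- A preference profile. Every agent owns exactly one object, so that the set `N` of agents is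
also the set of objects (agent `j` is endowed with object `j`). -/
abbrev Profile (N : Type*) := N → Preference N

variable {N : Type*}

/-- Object `k` is acceptable to agent `j`: it is at least as good as her endowment. -/
def Acceptable (R : Profile N) (j k : N) : Prop := (R j).weak k j

/-- An allocation: agent `j` receives object `x j`, and the allotments exhaust all objects
(for finite `N`, no object is assigned twice). -/
def IsAllocation (x : N → N) : Prop := Set.range x = Set.univ

/-- The non-empty coalition `S` weakly blocks `x`. -/
def WeaklyBlocks (R : Profile N) (S : Set N) (x : N → N) : Prop :=
  S.Nonempty ∧ ∃ z : N → N, IsAllocation z ∧ z '' S = S ∧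
    (∀ j ∈ S, (R j).weak (z j) (x j)) ∧ ∃ j ∈ S, (R j).strict (z j) (x j)

/-- The (possibly empty) strong core: the allocations that no coalition weakly blocks. -/
def strongCore (R : Profile N) : Set (N → N) :=
  {x | IsAllocation x ∧ ¬ ∃ S : Set N, WeaklyBlocks R S x}

/-- `R'` is an improvement for `i` with respect to `R`. -/
structure IsImprovement (i : N) (R R' : Profile N) : Prop where
  /-- The preferences of `i` do not change. -/
  same : R' i = R i
  /-- Object `i` loses ground to no acceptable object, in the eyes of any other agent. -/
  up : ∀ j, j ≠ i → ∀ k, Acceptable R j k →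
    ((R j).indiff i k → (R' j).weak i k) ∧ ((R j).strict i k → (R' j).strict i k)
  /-- The comparison of acceptable objects different from `i` does not change. -/
  others : ∀ j, j ≠ i → ∀ k l, k ≠ i → l ≠ i → Acceptable R j k → Acceptable R j l →
    ((R j).weak k l ↔ (R' j).weak k l)
  /-- No object other than `i` becomes acceptable to an agent other than `i`. -/
  unacceptable : ∀ j, j ≠ i → ∀ k, k ≠ i → ¬ Acceptable R j k → ¬ Acceptable R' j k

end HousingMarket

/-! A strong core allocation is supported by prices that are constant on its trading cycles, while
any object strictly better than one's allotment costs more than one's endowment. Suppose `i` prefers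
`x` to `x'`, with prices `p` and `p'`. A gain under one allocation raises the other's price along a
cycle, so that price must fall later on the cycle, at an agent who prefers the other allocation.
Alternating between `x`-cycles and `x'`-cycles, one only meets agents whose `p'` exceeds `p' i`.
Hence none of them receives `i` under `x'`, which is what lets their strict preferences pass between
`R` and `R'`. Each round raises `p`, which is impossible in a finite market. -/

/-- Reachable points are connected by a chain without repetitions. -/
theorem Relation.ReflTransGen.exists_nodup_isChain {α : Type*} {r : α → α → Prop} {a b : α}
    (h : Relation.ReflTransGen r a b) :
    ∃ l : List α, l.Nodup ∧ l.IsChain r ∧ l.head? = some a ∧ l.getLast? = some b := by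
  induction h using Relation.ReflTransGen.head_induction_on with
  | refl => exact ⟨[b], by simp⟩
  | @head a c hac _ ih =>
    obtain ⟨l, hnd, hch, hhd, hlast⟩ := ih
    -- If `a` already occurs, the chain is cut to start at that occurrence.
    by_cases ha : a ∈ l
    · obtain ⟨s, t, rfl⟩ := List.append_of_mem ha
      refine ⟨a :: t, hnd.of_append_right, hch.right_of_append, rfl, ?_⟩
      simpa [List.getLast?_append] using hlast
    · have hl : l ≠ [] := by rintro rfl; simp at hhd
      refine ⟨a :: l, List.nodup_cons.2 ⟨ha, hnd⟩, ?_, rfl, ?_⟩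
      · refine List.isChain_cons.2 ⟨fun y hy => ?_, hch⟩
        rw [hhd] at hy
        cases hy
        exact hac
      · rw [List.getLast?_cons, hlast]
        rfl

/-- If `f` increases at some step of an injective self-map of a finite type, then it decreases
later on the same orbit, at a point where it still exceeds its initial value. -/
theorem exists_iterate_lt_of_lt {α : Type*} [Finite α] {g : α → α} (hg : Function.Injective g)
    (f : α → ℕ) {a : α} (h : f a < f (g a)) :
    ∃ n, f a < f (g^[n] a) ∧ f (g (g^[n] a)) < f (g^[n] a) := by
  by_contra! hcon
  have key : ∀ n, f a < f (g^[n + 1] a) := by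
    intro n
    induction n with
    | zero => exact h
    | succ n ih =>
      have h1 := hcon (n + 1) ih
      rw [Function.iterate_succ_apply']
      exact ih.trans_le h1
  -- The orbit returns to `a`, where `f` cannot exceed `f a`.
  obtain ⟨n, hn, hp⟩ := Function.mem_periodicPts.1 (hg.mem_periodicPts a)
  have h2 := key (n - 1)
  rw [Nat.sub_add_cancel hn, hp.eq] at h2
  exact lt_irrefl _ h2

/-- A function that never decreases along an injective self-map of a finite type is invariant. -/
theorem apply_eq_of_forall_le {α : Type*} [Finite α] {g : α → α} (hg : Function.Injective g)
    (f : α → ℕ) (h : ∀ a, f a ≤ f (g a)) (a : α) : f (g a) = f a := by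
  by_contra hne
  obtain ⟨n, -, hn⟩ := exists_iterate_lt_of_lt hg f (lt_of_le_of_ne (h a) (Ne.symm hne))
  exact (h _).not_gt hn

namespace Preference

theorem strict_of_not_weak {X : Type*} (P : Preference X) {k l : X} (h : ¬ P.weak l k) :
    P.strict k l :=
  ⟨(P.complete k l).resolve_right h, h⟩

theorem weak_refl {X : Type*} (P : Preference X) (k : X) : P.weak k k :=
  (P.complete k k).elim id id

end Preference

namespace HousingMarket

theorem IsAllocation.injective {N : Type*} [Finite N] {x : N → N} (h : IsAllocation x) :
    Function.Injective x :=
  Finite.injective_iff_surjective.2 (Set.range_eq_univ.1 h)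

/-- A cycle of weak improvements over `x`, one of them strict, yields a weakly blocking
coalition. -/
theorem exists_weaklyBlocks_of_reflTransGen {N : Type*} {R : Profile N} {x : N → N} {j k : N}
    (hjk : (R j).strict k (x j))
    (h : Relation.ReflTransGen (fun a b => (R a).weak b (x a)) k j) :
    ∃ S : Set N, WeaklyBlocks R S x := by
  classical
  obtain ⟨l, hnd, hch, hhd, hlast⟩ := h.exists_nodup_isChain
  have hjl : j ∈ l := List.mem_of_getLast? hlast
  have hpos : 0 < l.length := List.length_pos_of_mem hjl
  have hlast' : l[l.length - 1] = j := by
    rw [List.getLast?_eq_getElem?, List.getElem?_eq_getElem (by omega)] at hlast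
    exact Option.some.inj hlast
  have hhd' : l[0] = k := by
    rw [List.head?_eq_getElem?, List.getElem?_eq_getElem hpos] at hhd
    exact Option.some.inj hhd
  -- The permutation wraps around: the strict improvement of `j` closes the chain into a trading
  -- cycle.
  have hzj : l.formPerm j = k := by
    have h1 := List.formPerm_apply_getElem l hnd (l.length - 1) (by omega)
    simp only [Nat.sub_add_cancel hpos, Nat.mod_self] at h1
    rwa [hlast', hhd'] at h1
  refine ⟨{a | a ∈ l}, ⟨j, hjl⟩, l.formPerm, l.formPerm.surjective.range_eq, ?_, ?_,
    j, hjl, by rwa [hzj]⟩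
  · ext a
    constructor
    · rintro ⟨b, hb, rfl⟩
      exact List.formPerm_apply_mem_of_mem hb
    · intro ha
      obtain ⟨b, rfl⟩ := l.formPerm.surjective a
      exact ⟨b, List.mem_of_formPerm_apply_mem ha, rfl⟩
  · intro a ha
    obtain ⟨n, hn, rfl⟩ := List.getElem_of_mem ha
    by_cases hn' : n + 1 < l.length
    · rw [List.formPerm_apply_lt_getElem l hnd n hn']
      exact List.isChain_iff_getElem.1 hch n hn'
    · have : n = l.length - 1 := by omega
      subst this
      rw [hlast', hzj]
      exact hjk.1

/-- Prices supporting a strong core allocation: objects weakly preferred to one's allotment cost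
at least as much as one's endowment, and strictly preferred objects cost more. -/
theorem exists_supporting_prices {N : Type*} [Finite N] {R : Profile N} {x : N → N}
    (hx : x ∈ strongCore R) :
    ∃ p : N → ℕ, (∀ j k, (R j).weak k (x j) → p j ≤ p k) ∧
      ∀ j k, (R j).strict k (x j) → p j < p k := by
  let r : N → N → Prop := fun a b => (R a).weak b (x a)
  have hsub : ∀ j k, (R j).weak k (x j) →
      {a | Relation.ReflTransGen r a j} ⊆ {a | Relation.ReflTransGen r a k} :=
    fun j k hjk a ha => Relation.ReflTransGen.tail ha hjk
  -- The price of an object counts the agents from whom it can be reached.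
  refine ⟨fun j => {a | Relation.ReflTransGen r a j}.ncard,
    fun j k hjk => Set.ncard_le_ncard (hsub j k hjk), fun j k hjk => Set.ncard_lt_ncard ?_⟩
  refine (Set.ssubset_iff_of_subset (hsub j k hjk.1)).2 ⟨k, Relation.ReflTransGen.refl, ?_⟩
  exact fun hkj => hx.2 (exists_weaklyBlocks_of_reflTransGen hjk hkj)

/-- Strong core allocations are individually rational. -/
theorem acceptable_of_mem_strongCore {N : Type*} {R : Profile N} {x : N → N}
    (hx : x ∈ strongCore R) (j : N) : Acceptable R j (x j) := by
  by_contra h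
  exact hx.2 (exists_weaklyBlocks_of_reflTransGen ((R j).strict_of_not_weak h) .refl)

/-- An acceptable strict preference for an object other than `i` over an acceptable one was
already present before the improvement for `i`. -/
theorem IsImprovement.strict_of_strict {N : Type*} {i : N} {R R' : Profile N}
    (h : IsImprovement i R R') {j k l : N} (hk : k ≠ i) (hkj : Acceptable R' j k)
    (hlj : Acceptable R j l) (hkl : (R' j).strict k l) : (R j).strict k l := by
  by_cases hj : j = i
  · subst hj
    rwa [h.same] at hkl
  have hkj' : Acceptable R j k := by
    by_contra hc
    exact h.unacceptable j hj k hk hc hkj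
  refine (R j).strict_of_not_weak fun hlk => hkl.2 ?_
  by_cases hl : l = i
  · subst hl
    by_cases hkl' : (R j).weak k l
    · exact (h.up j hj k hkj').1 ⟨hlk, hkl'⟩
    · exact ((h.up j hj k hkj').2 ⟨hlk, hkl'⟩).1
  · exact (h.others j hj l k hl hk hlj hkj').1 hlk

/-- A strict preference between acceptable objects, the worse of which is not `i`, survives an
improvement for `i`. -/
theorem IsImprovement.strict_improved {N : Type*} {i : N} {R R' : Profile N}
    (h : IsImprovement i R R') {j k l : N} (hl : l ≠ i) (hkj : Acceptable R j k)
    (hlj : Acceptable R' j l) (hkl : (R j).strict k l) : (R' j).strict k l := by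
  by_cases hj : j = i
  · subst hj
    rwa [h.same]
  have hlj' : Acceptable R j l := by
    by_contra hc
    exact h.unacceptable j hj l hl hc hlj
  by_cases hk : k = i
  · subst hk
    exact (h.up j hj l hlj').2 hkl
  · exact ⟨(h.others j hj k l hk hl hkj hlj').1 hkl.1,
      fun hc => hkl.2 ((h.others j hj l k hl hk hlj' hkj).2 hc)⟩

end HousingMarket

open HousingMarket in
theorem theorem2 {N : Type*} [Finite N] (i : N) (R R' : HousingMarket.Profile N)
    (himp : HousingMarket.IsImprovement i R R')
    (hne : (HousingMarket.strongCore R).Nonempty)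
    (hne' : (HousingMarket.strongCore R').Nonempty) :
    ∀ x' ∈ HousingMarket.strongCore R', ∀ x ∈ HousingMarket.strongCore R,
      (R i).weak (x' i) (x i) := by
  intro x' hx' x hx
  by_contra hi
  obtain ⟨p, hp, hps⟩ := exists_supporting_prices hx
  obtain ⟨p', hp', hps'⟩ := exists_supporting_prices hx'
  have hinj := hx.1.injective
  have hinj' := hx'.1.injective
  have hpx := apply_eq_of_forall_le hinj p fun j => hp j _ ((R j).weak_refl _)
  have hpx' := apply_eq_of_forall_le hinj' p' fun j => hp' j _ ((R' j).weak_refl _)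
  -- The bound `p' i ≤ p' k` is what later keeps `i` off the `x'`-cycles in use.
  let A : Set N := {k | p' i ≤ p' k ∧ (R' k).strict (x k) (x' k)}
  have hiA : i ∈ A := ⟨le_rfl, by rw [himp.same]; exact (R i).strict_of_not_weak hi⟩
  obtain ⟨k, ⟨hk, hks⟩, hmax⟩ := Set.exists_max_image A p A.toFinite ⟨i, hiA⟩
  -- Along the `x`-cycle of `k`, prices `p` are constant and some agent with a higher price `p'`
  -- strictly prefers `x'`.
  obtain ⟨n, hkm, hm⟩ := exists_iterate_lt_of_lt hinj p' (hps' k _ hks)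
  have hpm : p (x^[n] k) = p k := by
    simpa using congrFun (Function.iterate_invariant (funext hpx) n) k
  generalize x^[n] k = m at hkm hm hpm
  have hmi : x' m ≠ i := by
    intro hc
    have := hpx' m
    rw [hc] at this
    omega
  have hms : (R m).strict (x' m) (x m) :=
    himp.strict_of_strict hmi (acceptable_of_mem_strongCore hx' m)
      (acceptable_of_mem_strongCore hx m)
      ((R' m).strict_of_not_weak fun hc => (hp' m _ hc).not_gt hm)
  -- Symmetrically along the `x'`-cycle of `m`, which avoids `i`.
  obtain ⟨n', hmq, hq⟩ := exists_iterate_lt_of_lt hinj' p (hps m _ hms)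
  have hpq : p' (x'^[n'] m) = p' m := by
    simpa using congrFun (Function.iterate_invariant (funext hpx') n') m
  generalize x'^[n'] m = q at hmq hq hpq
  have hqi : x' q ≠ i := by
    intro hc
    have := hpx' q
    rw [hc] at this
    omega
  have hqs : (R' q).strict (x q) (x' q) :=
    himp.strict_improved hqi (acceptable_of_mem_strongCore hx q)
      (acceptable_of_mem_strongCore hx' q)
      ((R q).strict_of_not_weak fun hc => (hp q _ hc).not_gt hq)
  -- `q` lies in `A`, yet `p q > p m = p k`, against the choice of `k`.
  have := hmax q ⟨by omega, hqs⟩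
  omega
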